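/- Let $F$ be a field, $A=F[T]$, $K=F(T)$, with the absolute value $|f/g|=\exp(\deg f-\deg g)$ (and $|0|=0$), let $K_\infty=F((1/T))$ be the completion of $K$ with the extended absolute value, and let $n\ge 2$ be an integer. Equip $K_\infty^n$ with the maximum norm $\|\mathbf x\|=\max_i|x_i|$ and write $\mathbf x\cdot\mathbf y=\sum_i x_iy_i$. For $\mathbf u\in K_\infty^n$ with $\|\mathbf u\|=1$, for $q\in[0,\infty)$ and $i\in\{1,\dots,n\}$, let $L_{\mathbf u,i}(q)$ be the minimum of all real $t\ge 0$ for which the solutions $\mathbf x\in A^n$ of $$\|\mathbf x\|\le e^{t}\quad\text{and}\quad |\mathbf u\cdot\mathbf x|\le e^{t-q}$$ span a subspace of $K^n$ of dimension at least $i$ (this minimum exists), and let $\mathbf L_{\mathbf u}=(L_{\mathbf u,1},\dots,L_{\mathbf u,n})\colon[0,\infty)\to\mathbb R^n$. An $n$-system on $[0,\infty)$ is a map $\mathbf P=(P_1,\dots,P_n)\colon[0,\infty)\to\mathbb R^n$ such that, for each $q\ge 0$: (S1) $0\le P_1(q)\le\cdots\le P_n(q)$ and $P_1(q)+\cdots+P_n(q)=q$;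 (S2) there exist $\epsilon>0$ and $k,\ell\in\{1,\dots,n\}$ such that $\mathbf P(t)=\mathbf P(q)+(t-q)\mathbf e_\ell$ when $\max\{0,q-\epsilon\}\le t\le q$, and $\mathbf P(t)=\mathbf P(q)+(t-q)\mathbf e_k$ when $q\le t\le q+\epsilon$, where $(\mathbf e_1,\dots,\mathbf e_n)$ is the canonical basis of $\mathbb R^n$; (S3) if $q>0$ and the integers $k,\ell$ from (S2) satisfy $k>\ell$, then $P_\ell(q)=\cdots=P_k(q)$. Then the set of maps $\mathbf L_{\mathbf u}$, where $\mathbf u$ runs through the elements of $K_\infty^n$ of norm $1$, is equal to the set of $n$-systems $\mathbf P$ on $[0,\infty)$ with $\mathbf P(q)\in\mathbb Z^n$ for each integer $q\ge 0$. -/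

import Mathlib

open scoped Polynomial NNReal

noncomputable section

namespace ParamGeom

open Classical in
/-- The absolute value `|x|` on `K_∞ = F((1/T))`, the completion of `F(T)` at infinity, normalized
by `|f / g| = exp (deg f - deg g)` on `F(T)` and `|0| = 0`. -/
def absInf {F : Type*} [Field F] [DecidableEq (RatFunc F)] (x : RatFunc.CompletionAtInfty F) : ℝ :=
  if x = 0 then 0 else Real.exp ((WithZero.log (Valued.v x) : ℤ) : ℝ)

/-- The maximum norm on `K_∞ ^ n`. -/
def supNorm {F : Type*} [Field F] [DecidableEq (RatFunc F)] {n : ℕ}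
    (x : Fin n → RatFunc.CompletionAtInfty F) : ℝ :=
  ⨆ i, absInf (x i)

/-- The inclusion of `A ^ n` in `K ^ n`, where `A = F[T]` and `K = F(T)`. -/
def toRat {F : Type*} [Field F] {n : ℕ} (x : Fin n → F[X]) : Fin n → RatFunc F :=
  fun i => algebraMap F[X] (RatFunc F) (x i)

/-- The inclusion of `A ^ n` in `K_∞ ^ n`. -/
def toInf {F : Type*} [Field F] [DecidableEq (RatFunc F)] {n : ℕ} (x : Fin n → F[X]) :
    Fin n → RatFunc.CompletionAtInfty F :=
  fun i => algebraMap (RatFunc F) (RatFunc.CompletionAtInfty F) (toRat x i)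

/-- The points `x` of `A ^ n` with `‖x‖ ≤ exp t` and `|u · x| ≤ exp (t - q)`. -/
def solutions {F : Type*} [Field F] [DecidableEq (RatFunc F)] {n : ℕ}
    (u : Fin n → RatFunc.CompletionAtInfty F) (q t : ℝ) : Set (Fin n → F[X]) :=
  {x | supNorm (toInf x) ≤ Real.exp t ∧ absInf (∑ i, u i * toInf x i) ≤ Real.exp (t - q)}

/-- The real numbers `t ≥ 0` for which the solutions span a subspace of `K ^ n` of dimension at
least `j`. -/
def minimaSet {F : Type*} [Field F] [DecidableEq (RatFunc F)] {n : ℕ}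
    (u : Fin n → RatFunc.CompletionAtInfty F) (q : ℝ) (j : ℕ) : Set ℝ :=
  {t | 0 ≤ t ∧
    j ≤ Module.finrank (RatFunc F) (Submodule.span (RatFunc F) (toRat '' solutions u q t))}

/-- The map `L_u : [0, ∞) → ℝ ^ n`. The coordinate with index `i : Fin n` is the `(i + 1)`-st
logarithmic minimum; the infimum is a minimum when `‖u‖ = 1`, see `isLeast_logMinima`. -/
def logMinima {F : Type*} [Field F] [DecidableEq (RatFunc F)] {n : ℕ}
    (u : Fin n → RatFunc.CompletionAtInfty F) : ℝ≥0 → Fin n → ℝ :=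
  fun q i => sInf (minimaSet u (q : ℝ) ((i : ℕ) + 1))

/-- An `n`-system on `[0, ∞)`. In `slopes`, the index `k` is determined by `P` and `q`, and so is
`l` when `q > 0`. -/
structure IsNSystem {n : ℕ} (P : ℝ≥0 → Fin n → ℝ) : Prop where
  nonneg : ∀ q i, 0 ≤ P q i
  mono : ∀ q, Monotone (P q)
  sum_eq : ∀ q, ∑ i, P q i = (q : ℝ)
  slopes : ∀ q : ℝ≥0, ∃ ε : ℝ, 0 < ε ∧ ∃ k l : Fin n,
    (∀ t : ℝ≥0, (q : ℝ) - ε ≤ t → t ≤ q →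
      P t = P q + ((t : ℝ) - q) • (Pi.single l 1 : Fin n → ℝ)) ∧
    (∀ t : ℝ≥0, q ≤ t → (t : ℝ) ≤ q + ε →
      P t = P q + ((t : ℝ) - q) • (Pi.single k 1 : Fin n → ℝ)) ∧
    (0 < q → l < k → ∀ j, l ≤ j → j ≤ k → P q j = P q l)

theorem absInf_nonneg {F : Type*} [Field F] [DecidableEq (RatFunc F)]
    (x : RatFunc.CompletionAtInfty F) : 0 ≤ absInf x := by
  unfold absInf; split_ifs <;> positivity

theorem absInf_le_iff_floor {F : Type*} [Field F] [DecidableEq (RatFunc F)]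
    (x : RatFunc.CompletionAtInfty F) (t : ℝ) :
    absInf x ≤ Real.exp t ↔ absInf x ≤ Real.exp (⌊t⌋ : ℝ) := by
  unfold absInf
  split_ifs
  · simp [Real.exp_nonneg]
  · rw [Real.exp_le_exp, Real.exp_le_exp, Int.cast_le, Int.le_floor]

theorem supNorm_le_iff {F : Type*} [Field F] [DecidableEq (RatFunc F)] {n : ℕ}
    (x : Fin n → RatFunc.CompletionAtInfty F) {c : ℝ} (hc : 0 ≤ c) :
    supNorm x ≤ c ↔ ∀ i, absInf (x i) ≤ c :=
  ⟨fun h i => (le_ciSup (Set.finite_range fun i => absInf (x i)).bddAbove i).trans h,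
    fun h => Real.iSup_le h hc⟩

theorem solutions_eq_floor {F : Type*} [Field F] [DecidableEq (RatFunc F)] {n : ℕ}
    (u : Fin n → RatFunc.CompletionAtInfty F) (q s t : ℝ) (h1 : ⌊s⌋ = ⌊t⌋)
    (h2 : ⌊s - q⌋ = ⌊t - q⌋) : solutions u q s = solutions u q t := by
  ext x
  simp only [solutions, Set.mem_ofPred_eq]
  rw [absInf_le_iff_floor _ (s - q), absInf_le_iff_floor _ (t - q), h2,
    supNorm_le_iff _ (Real.exp_nonneg _), supNorm_le_iff _ (Real.exp_nonneg _)]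
  have : ∀ i, absInf (toInf x i) ≤ Real.exp s ↔ absInf (toInf x i) ≤ Real.exp t := fun i => by
    rw [absInf_le_iff_floor _ s, absInf_le_iff_floor _ t, h1]
  simp only [this]

theorem absInf_zero {F : Type*} [Field F] [DecidableEq (RatFunc F)] :
    absInf (0 : RatFunc.CompletionAtInfty F) = 0 := by
  simp [absInf]

theorem absInf_one {F : Type*} [Field F] [DecidableEq (RatFunc F)] :
    absInf (1 : RatFunc.CompletionAtInfty F) = 1 := by
  simp [absInf]

theorem toInf_single {F : Type*} [Field F] [DecidableEq (RatFunc F)] {n : ℕ} (j : Fin n) :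
    toInf (Pi.single j 1 : Fin n → F[X]) = Pi.single j 1 := by
  ext i
  by_cases h : i = j
  · subst h; simp [toInf, toRat]
  · simp [toInf, toRat, h]

theorem toRat_single {F : Type*} [Field F] {n : ℕ} (j : Fin n) :
    toRat (Pi.single j 1 : Fin n → F[X]) = Pi.single j 1 := by
  ext i
  by_cases h : i = j
  · subst h; simp [toRat]
  · simp [toRat, h]

/-- The real number `q` belongs to each of the sets whose minima are `L_u(q)`. -/
theorem mem_minimaSet_self {F : Type*} [Field F] [DecidableEq (RatFunc F)] {n : ℕ}
    (u : Fin n → RatFunc.CompletionAtInfty F) (hu : supNorm u = 1) {q : ℝ} (hq : 0 ≤ q) {j : ℕ}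
    (hj : j ≤ n) : q ∈ minimaSet u q j := by
  refine ⟨hq, ?_⟩
  have hs : ∀ j : Fin n, (Pi.single j 1 : Fin n → F[X]) ∈ solutions u q q := by
    intro j
    refine ⟨(supNorm_le_iff _ (Real.exp_nonneg _)).2 fun i => ?_, ?_⟩
    · rw [toInf_single]
      by_cases h : i = j
      · subst h; simpa [absInf_one] using hq
      · simp [h, absInf_zero, Real.exp_nonneg]
    · rw [toInf_single]
      simpa [Pi.single_apply] using (supNorm_le_iff u zero_le_one).1 hu.le j
  have : Submodule.span (RatFunc F) (toRat '' solutions u q q) = ⊤ := by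
    rw [eq_top_iff, ← (Pi.basisFun (RatFunc F) (Fin n)).span_eq]
    refine Submodule.span_mono ?_
    rintro _ ⟨i, rfl⟩
    exact ⟨_, hs i, by simp [toRat_single]⟩
  rw [this]
  simpa using hj

/-- The numbers `t` slightly above a given `s` give the same solutions as `s`. -/
theorem exists_solutions_eq {F : Type*} [Field F] [DecidableEq (RatFunc F)] {n : ℕ}
    (u : Fin n → RatFunc.CompletionAtInfty F) (q s : ℝ) :
    ∃ r, s < r ∧ ∀ t, s ≤ t → t < r → solutions u q t = solutions u q s := by
  refine ⟨min (⌊s⌋ + 1) (⌊s - q⌋ + 1 + q), lt_min (Int.lt_floor_add_one s) ?_, fun t h1 h2 => ?_⟩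
  · linarith [Int.lt_floor_add_one (s - q)]
  · have h3 := Int.floor_le s
    have h4 := Int.floor_le (s - q)
    have h5 := lt_min_iff.1 h2
    apply solutions_eq_floor
    · rw [Int.floor_eq_iff]; constructor <;> linarith [h5.1]
    · rw [Int.floor_eq_iff]; constructor <;> linarith [h5.2]

/-- The minimum that defines `L_u` exists. -/
theorem isLeast_logMinima {F : Type*} [Field F] [DecidableEq (RatFunc F)] {n : ℕ}
    (u : Fin n → RatFunc.CompletionAtInfty F) (hu : supNorm u = 1) (q : ℝ≥0) (i : Fin n) :
    IsLeast (minimaSet u (q : ℝ) ((i : ℕ) + 1)) (logMinima u q i) := by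
  have hne : (minimaSet u (q : ℝ) ((i : ℕ) + 1)).Nonempty :=
    ⟨_, mem_minimaSet_self u hu q.2 i.2⟩
  have hbd : BddBelow (minimaSet u (q : ℝ) ((i : ℕ) + 1)) := ⟨0, fun t ht => ht.1⟩
  refine ⟨?_, fun t ht => csInf_le hbd ht⟩
  obtain ⟨r, hr, h⟩ := exists_solutions_eq u (q : ℝ) (logMinima u q i)
  obtain ⟨t, ht, htr⟩ := exists_lt_of_csInf_lt hne hr
  have := h t (csInf_le hbd ht) htr
  refine ⟨le_csInf hne fun t ht => ht.1, ?_⟩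
  rw [← this]
  exact ht.2

end ParamGeom

end

/-! The proof follows, for integers `m`, bases of `A ^ n` reduced for the norm `max (‖x‖, e ^ m |u ·
x|)`: the top-degree data of the basis elements are independent over `F`, so no cancellation occurs
in `A`-linear combinations and the levels of the basis are the logarithmic minima. By elimination
one can arrange that `u · x i` reaches its maximal degree `L i - m` for a single index `k`
(`IsReduced.exists_isAdapted`). As `q` runs from `m` to `m + 1`, only the `k`-th level then rises,
with slope one (`IsAdapted.logMinima_eq`).

At `m + 1` the same basis is reduced for the levels `L + e_k`, and the leading coefficient `c k` of
`u · x k` is nonzero (`IsAdapted.isReduced_succ`). The next pivot `k'` has the least level among the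
indices with nonzero coefficient, so its level is at most that of `k`. With the ordering of the
levels, this inequality is exactly (S3) at an integer.

Conversely, the top coefficient vectors of the `x i` with `i ≠ k` are independent, so changing the
coefficients of `T ^ (-m - 1)` in `u` prescribes all `c i` with `i ≠ k` and leaves `c k` alone.
Hence every `k'` allowed by the inequality can be made the next pivot (`IsAdapted.exists_succ`).
Such a change does not affect the earlier stages (`IsAdapted.congr`), and the successive changes
converge in `K_∞`. Finally, integral `n`-systems are exactly the interpolations of such discrete
paths. -/

noncomputable section

namespace ParamGeom

open Filter Topology
open WithZero (exp)
open scoped WithZero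

/-! ### Valuation and leading coefficients in `K_∞`. -/

section Infinity

variable {F : Type*} [Field F] [DecidableEq (RatFunc F)]

/-- The ring homomorphism from `F[T]` to `K_∞`. -/
def polyInf : F[X] →+* RatFunc.CompletionAtInfty F :=
  (algebraMap (RatFunc F) (RatFunc.CompletionAtInfty F)).comp (algebraMap F[X] (RatFunc F))

/-- The element `T` of `K_∞`. -/
def varInf : RatFunc.CompletionAtInfty F :=
  algebraMap (RatFunc F) (RatFunc.CompletionAtInfty F) RatFunc.X

theorem polyInf_X : polyInf (Polynomial.X : F[X]) = varInf := by
  simp [polyInf, varInf, RatFunc.algebraMap_X]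

theorem v_algebraMap (r : RatFunc F) :
    Valued.v (algebraMap (RatFunc F) (RatFunc.CompletionAtInfty F) r) =
      RatFunc.inftyValuation F r := by
  let := RatFunc.inftyValued F
  exact Valued.valuedCompletion_apply r

theorem v_varInf : Valued.v (varInf : RatFunc.CompletionAtInfty F) = exp 1 := by
  rw [varInf, v_algebraMap, RatFunc.inftyValuation.X]

theorem v_varInf_zpow (N : ℤ) :
    Valued.v ((varInf : RatFunc.CompletionAtInfty F) ^ N) = exp N := by
  rw [map_zpow₀, v_varInf, ← WithZero.exp_zsmul]; simp

theorem varInf_ne_zero : (varInf : RatFunc.CompletionAtInfty F) ≠ 0 := by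
  intro h
  have := v_varInf (F := F)
  rw [h, map_zero] at this
  exact WithZero.exp_ne_zero this.symm

theorem v_polyInf {p : F[X]} (hp : p ≠ 0) : Valued.v (polyInf p) = exp (p.natDegree : ℤ) :=
  (v_algebraMap _).trans (RatFunc.inftyValuation.polynomial F hp)

theorem v_polyInf_le (p : F[X]) (N : ℕ) :
    Valued.v (polyInf p) ≤ exp (N : ℤ) ↔ p.natDegree ≤ N := by
  by_cases hp : p = 0
  · simp [hp]
  · rw [v_polyInf hp, WithZero.exp_le_exp]; exact_mod_cast Iff.rfl

theorem v_polyInf_C_le (c : F) : Valued.v (polyInf (Polynomial.C c)) ≤ 1 := by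
  simpa using (v_polyInf_le (Polynomial.C c) 0).2 (by simp)

theorem v_polyInf_C {c : F} (hc : c ≠ 0) : Valued.v (polyInf (Polynomial.C c)) = 1 := by
  rw [v_polyInf (by simpa using hc)]; simp

theorem exists_ratFunc_approx (y : RatFunc.CompletionAtInfty F) (N : ℤ) :
    ∃ r : RatFunc F, Valued.v (y - algebraMap (RatFunc F) _ r) < exp N := by
  have hd : DenseRange (algebraMap (RatFunc F) (RatFunc.CompletionAtInfty F)) := by
    let := RatFunc.inftyValued F
    exact UniformSpace.Completion.denseRange_coe
  have ho : IsOpen {z : RatFunc.CompletionAtInfty F | Valued.v (y - z) < exp N} := by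
    have := Valued.isOpen_ball (RatFunc.CompletionAtInfty F)
      (Valued.v.restrict (varInf ^ N : RatFunc.CompletionAtInfty F))
    simp only [Valuation.restrict_lt_iff, v_varInf_zpow] at this
    exact this.preimage (continuous_const.sub continuous_id)
  obtain ⟨r, hr⟩ := hd.exists_mem_open ho ⟨y, by simp⟩
  exact ⟨r, hr⟩

/-- A sequence whose successive differences decrease in value converges. -/
theorem exists_limit (s : ℕ → RatFunc.CompletionAtInfty F)
    (hs : ∀ m : ℕ, Valued.v (s (m + 1) - s m) ≤ exp (-(m : ℤ) - 1)) :
    ∃ y, ∀ m : ℕ, Valued.v (y - s m) ≤ exp (-(m : ℤ) - 1) := by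
  have hle : ∀ m k : ℕ, Valued.v (s (m + k) - s m) ≤ exp (-(m : ℤ) - 1) := by
    intro m k
    induction k with
    | zero => simp
    | succ k ih =>
      have : s (m + (k + 1)) - s m = (s (m + k + 1) - s (m + k)) + (s (m + k) - s m) := by
        rw [← add_assoc]; ring
      rw [this]
      refine (Valuation.map_add _ _ _).trans (max_le ((hs _).trans ?_) ih)
      rw [WithZero.exp_le_exp]; push_cast; linarith
  have hc : CauchySeq s := by
    rw [CauchySeq, Valued.cauchy_iff]
    refine ⟨inferInstance, fun γ => ?_⟩
    obtain ⟨N, hN⟩ : ∃ N : ℕ,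
        (Valued.v.restrict (varInf ^ (-(N : ℤ) - 1) : RatFunc.CompletionAtInfty F)) < γ.1 := by
      obtain ⟨z, hz⟩ := MonoidWithZeroHom.ValueGroup₀.restrict₀_surjective _ γ.1
      rw [← Valuation.restrict_def] at hz
      have hz0 : Valued.v z ≠ 0 := by
        intro h
        rw [map_eq_zero] at h
        rw [h, map_zero] at hz
        exact γ.ne_zero hz.symm
      refine ⟨(-(WithZero.log (Valued.v z))).toNat, ?_⟩
      rw [← hz, Valuation.restrict_lt_iff, v_varInf_zpow, ← WithZero.lt_log_iff_exp_lt hz0]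
      omega
    refine ⟨s '' Set.Ici N, image_mem_map (Ici_mem_atTop N), ?_⟩
    rintro _ ⟨a, ha, rfl⟩ _ ⟨b, hb, rfl⟩
    refine lt_of_le_of_lt ?_ hN
    rw [Valuation.restrict_le_iff, v_varInf_zpow]
    obtain ⟨a, rfl⟩ := Nat.exists_eq_add_of_le ha
    obtain ⟨b, rfl⟩ := Nat.exists_eq_add_of_le hb
    have : s (N + b) - s (N + a) = (s (N + b) - s N) - (s (N + a) - s N) := by ring
    rw [this]
    exact (Valuation.map_sub _ _ _).trans (max_le (hle _ _) (hle _ _))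
  have hcomplete : CompleteSpace (RatFunc.CompletionAtInfty F) := by
    let := RatFunc.inftyValued F
    exact inferInstanceAs (CompleteSpace (UniformSpace.Completion (RatFunc F)))
  obtain ⟨y, hy⟩ := cauchySeq_tendsto_of_complete hc
  refine ⟨y, fun m => ?_⟩
  have hcl : IsClosed {z : RatFunc.CompletionAtInfty F |
      Valued.v (z - s m) ≤ exp (-(m : ℤ) - 1)} := by
    have := Valued.isClosed_closedBall (RatFunc.CompletionAtInfty F)
      (Valued.v.restrict (varInf ^ (-(m : ℤ) - 1) : RatFunc.CompletionAtInfty F))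
    simp only [Valuation.restrict_le_iff, v_varInf_zpow] at this
    exact this.preimage (continuous_id.sub continuous_const)
  refine hcl.mem_of_tendsto hy (eventually_atTop.2 ⟨m, fun k hk => ?_⟩)
  obtain ⟨k, rfl⟩ := Nat.exists_eq_add_of_le hk
  exact hle m k

/-- `c` is the coefficient of `T ^ N` in `y`, an element of `K_∞` of degree at most `N`. -/
def HasLead (y : RatFunc.CompletionAtInfty F) (N : ℤ) (c : F) : Prop :=
  Valued.v (y - polyInf (Polynomial.C c) * varInf ^ N) < exp N

theorem v_C_mul_varInf_zpow_le (c : F) (N : ℤ) :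
    Valued.v (polyInf (Polynomial.C c) * varInf ^ N) ≤ exp N := by
  rw [map_mul, v_varInf_zpow]
  exact mul_le_of_le_one_left' (v_polyInf_C_le c)

namespace HasLead

variable {y z : RatFunc.CompletionAtInfty F} {N M : ℤ} {c d : F}

theorem zero_iff : HasLead y N 0 ↔ Valued.v y < exp N := by simp [HasLead]

theorem v_le (h : HasLead y N c) : Valued.v y ≤ exp N := by
  have := Valuation.map_add Valued.v (y - polyInf (Polynomial.C c) * varInf ^ N)
    (polyInf (Polynomial.C c) * varInf ^ N)
  rw [sub_add_cancel] at this
  exact this.trans (max_le (le_of_lt h) (v_C_mul_varInf_zpow_le c N))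

theorem v_eq (h : HasLead y N c) (hc : c ≠ 0) : Valued.v y = exp N := by
  have h1 : Valued.v (polyInf (Polynomial.C c) * varInf ^ N) = exp N := by
    rw [map_mul, v_varInf_zpow, v_polyInf_C hc, one_mul]
  rw [← h1]
  exact Valuation.map_eq_of_sub_lt _ (h1.symm ▸ h)

theorem add (h : HasLead y N c) (h' : HasLead z N d) : HasLead (y + z) N (c + d) := by
  have : y + z - polyInf (Polynomial.C (c + d)) * varInf ^ N =
      (y - polyInf (Polynomial.C c) * varInf ^ N) +
        (z - polyInf (Polynomial.C d) * varInf ^ N) := by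
    rw [map_add, map_add]; ring
  rw [HasLead, this]
  exact (Valuation.map_add _ _ _).trans_lt (max_lt h h')

theorem zero : HasLead (0 : RatFunc.CompletionAtInfty F) N 0 := by
  simp [zero_iff]

theorem sum {ι : Type*} (s : Finset ι) (f : ι → RatFunc.CompletionAtInfty F) (g : ι → F)
    (h : ∀ i ∈ s, HasLead (f i) N (g i)) : HasLead (∑ i ∈ s, f i) N (∑ i ∈ s, g i) := by
  classical
  induction s using Finset.induction_on with
  | empty => simpa using zero
  | insert a s ha ih =>
    rw [Finset.sum_insert ha, Finset.sum_insert ha]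
    exact (h a (by simp)).add (ih fun i hi => h i (by simp [hi]))

theorem mul (h : HasLead y N c) (h' : HasLead z M d) : HasLead (y * z) (N + M) (c * d) := by
  have : y * z - polyInf (Polynomial.C (c * d)) * varInf ^ (N + M) =
      (y - polyInf (Polynomial.C c) * varInf ^ N) * z +
        (polyInf (Polynomial.C c) * varInf ^ N) * (z - polyInf (Polynomial.C d) * varInf ^ M) := by
    rw [map_mul, map_mul, zpow_add₀ varInf_ne_zero]; ring
  rw [HasLead, this, WithZero.exp_add]
  refine (Valuation.map_add _ _ _).trans_lt (max_lt ?_ ?_)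
  · rw [map_mul]
    exact (mul_le_mul_right h'.v_le _).trans_lt (mul_lt_mul_of_pos_right h WithZero.exp_pos)
  · rw [map_mul]
    exact (mul_le_mul_left (v_C_mul_varInf_zpow_le c N) _).trans_lt
      (mul_lt_mul_of_pos_left h' WithZero.exp_pos)

theorem div (h : HasLead y N c) (h' : HasLead z M d) (hd : d ≠ 0) :
    HasLead (y / z) (N - M) (c / d) := by
  have hz := h'.v_eq hd
  have hz0 : z ≠ 0 := by
    rintro rfl
    rw [map_zero] at hz
    exact WithZero.exp_ne_zero hz.symm
  have h1 : HasLead (polyInf (Polynomial.C (c / d)) * varInf ^ (N - M)) (N - M) (c / d) := by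
    rw [HasLead, sub_self, map_zero]
    exact WithZero.exp_pos
  have h2 := h1.mul h'
  rw [sub_add_cancel, div_mul_cancel₀ c hd] at h2
  have h3 : Valued.v (y - polyInf (Polynomial.C (c / d)) * varInf ^ (N - M) * z) < exp N := by
    rw [← sub_sub_sub_cancel_right _ _ (polyInf (Polynomial.C c) * varInf ^ N)]
    exact (Valuation.map_sub _ _ _).trans_lt (max_lt h h2)
  rw [HasLead, ← mul_div_cancel_right₀ (polyInf (Polynomial.C (c / d)) * varInf ^ (N - M)) hz0,
    ← sub_div, map_div₀, hz, WithZero.exp_sub, div_eq_mul_inv (Valued.v _),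
    div_eq_mul_inv (exp N)]
  exact mul_lt_mul_of_pos_right h3 (inv_pos.2 WithZero.exp_pos)

theorem polyInf {p : F[X]} {N : ℕ} (hp : p.natDegree ≤ N) :
    HasLead (ParamGeom.polyInf p) N (p.coeff N) := by
  rw [HasLead, zpow_natCast, ← polyInf_X, ← map_pow, ← map_mul, ← map_sub]
  set q := p - Polynomial.C (p.coeff N) * Polynomial.X ^ N with hq
  by_cases hq0 : q = 0
  · simp [hq0]
  rw [v_polyInf hq0, WithZero.exp_lt_exp, Nat.cast_lt, Polynomial.natDegree_lt_iff_degree_lt hq0,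
    Polynomial.degree_lt_iff_coeff_zero]
  intro k hk
  rcases hk.eq_or_lt with rfl | hk
  · simp [hq]
  · rw [hq, Polynomial.coeff_sub, Polynomial.coeff_eq_zero_of_natDegree_lt (hp.trans_lt hk)]
    simp [Polynomial.coeff_X_pow, hk.ne']

/-- The residue field is `F`: density reduces to a rational function, whose leading coefficient is
the quotient of those of its numerator and denominator. -/
theorem exists_of_v_le (h : Valued.v y ≤ exp N) : ∃ c : F, HasLead y N c := by
  obtain ⟨r, hr⟩ := exists_ratFunc_approx y N
  suffices ∃ c : F, HasLead (algebraMap (RatFunc F) (RatFunc.CompletionAtInfty F) r) N c by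
    obtain ⟨c, hc⟩ := this
    refine ⟨c, ?_⟩
    have := (zero_iff.2 hr).add hc
    rwa [sub_add_cancel, zero_add] at this
  have hrN : Valued.v (algebraMap (RatFunc F) (RatFunc.CompletionAtInfty F) r) ≤ exp N := by
    rw [← sub_sub_cancel y (algebraMap (RatFunc F) (RatFunc.CompletionAtInfty F) r)]
    exact (Valuation.map_sub _ _ _).trans (max_le h hr.le)
  rcases hrN.lt_or_eq with hlt | heq
  · exact ⟨0, zero_iff.2 hlt⟩
  have hr0 : r ≠ 0 := by
    rintro rfl
    rw [map_zero, map_zero] at heq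
    exact WithZero.exp_ne_zero heq.symm
  rw [v_algebraMap, RatFunc.inftyValuation_apply, RatFunc.inftyValuation_of_nonzero F hr0,
    WithZero.exp_inj, RatFunc.intDegree] at heq
  refine ⟨r.num.coeff r.num.natDegree / r.denom.coeff r.denom.natDegree, ?_⟩
  have := (HasLead.polyInf (le_refl r.num.natDegree)).div
    (HasLead.polyInf (le_refl r.denom.natDegree)) (by simpa using r.denom_ne_zero)
  rw [heq] at this
  convert! this using 1
  rw [ParamGeom.polyInf, RingHom.comp_apply, RingHom.comp_apply, ← map_div₀, RatFunc.num_div_denom]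

end HasLead

theorem absInf_le_exp_iff (y : RatFunc.CompletionAtInfty F) (t : ℝ) :
    absInf y ≤ Real.exp t ↔ Valued.v y ≤ exp ⌊t⌋ := by
  unfold absInf
  split_ifs with h
  · simp [h, Real.exp_nonneg]
  · rw [Real.exp_le_exp, ← Int.le_floor, WithZero.log_le_iff_le_exp]
    simpa using h

end Infinity

/-! ### Reduced and adapted bases of `A ^ n`. -/

section Bases

open Polynomial (C X)

variable {F : Type*} [Field F] [DecidableEq (RatFunc F)] {n : ℕ}

/-- The product `u · x` for `u` in `K_∞ ^ n` and `x` in `A ^ n`. -/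
def dotInf (u : Fin n → RatFunc.CompletionAtInfty F) (x : Fin n → F[X]) :
    RatFunc.CompletionAtInfty F :=
  ∑ j, u j * polyInf (x j)

/-- The vector of the coefficients of `T ^ N` in the coordinates of `x`. -/
def coeffVec (x : Fin n → F[X]) (N : ℕ) : Fin n → F := fun j => (x j).coeff N

theorem dotInf_add (u : Fin n → RatFunc.CompletionAtInfty F) (x y : Fin n → F[X]) :
    dotInf u (x + y) = dotInf u x + dotInf u y := by
  simp [dotInf, mul_add, Finset.sum_add_distrib]

theorem dotInf_smul (u : Fin n → RatFunc.CompletionAtInfty F) (p : F[X]) (x : Fin n → F[X]) :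
    dotInf u (p • x) = polyInf p * dotInf u x := by
  simp only [dotInf, Finset.mul_sum, Pi.smul_apply, smul_eq_mul, map_mul]
  exact Finset.sum_congr rfl fun _ _ => by ring

theorem dotInf_sum {ι : Type*} (u : Fin n → RatFunc.CompletionAtInfty F) (s : Finset ι)
    (x : ι → Fin n → F[X]) : dotInf u (∑ i ∈ s, x i) = ∑ i ∈ s, dotInf u (x i) := by
  simp only [dotInf, Finset.sum_apply, map_sum, Finset.mul_sum]
  exact Finset.sum_comm

theorem dotInf_add_left (u w : Fin n → RatFunc.CompletionAtInfty F) (x : Fin n → F[X]) :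
    dotInf (u + w) x = dotInf u x + dotInf w x := by
  simp [dotInf, add_mul, Finset.sum_add_distrib]

theorem v_lt_exp_iff (y : RatFunc.CompletionAtInfty F) (N : ℤ) :
    Valued.v y < exp N ↔ Valued.v y ≤ exp (N - 1) := by
  by_cases h : Valued.v y = 0
  · simp [h]
  · rw [← WithZero.log_lt_iff_lt_exp h, ← WithZero.log_le_iff_le_exp h, Int.le_sub_one_iff]

theorem v_dotInf_le {w : Fin n → RatFunc.CompletionAtInfty F} {x : Fin n → F[X]} {M : ℤ} {N : ℕ}
    (hw : ∀ j, Valued.v (w j) ≤ exp M) (hx : ∀ j, (x j).natDegree ≤ N) :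
    Valued.v (dotInf w x) ≤ exp (N + M) := by
  refine Valuation.map_sum_le _ fun j _ => ?_
  rw [map_mul, add_comm, WithZero.exp_add]
  exact mul_le_mul' (hw j) ((v_polyInf_le _ _).2 (hx j))

/-- A basis `x` of `A ^ n` reduced with respect to the norm `max (‖x‖, e ^ m |u · x|)`, the
logarithms of the norms of its elements being given by `L`. The coefficient of `T ^ (L i - m)` in
`u · x i` is `c i`. -/
structure IsReduced (u : Fin n → RatFunc.CompletionAtInfty F) (m : ℕ) (x : Fin n → Fin n → F[X])
    (L : Fin n → ℕ) (c : Fin n → F) : Prop where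
  span : Submodule.span F[X] (Set.range x) = ⊤
  natDegree_le : ∀ i j, (x i j).natDegree ≤ L i
  lead : ∀ i, HasLead (dotInf u (x i)) (L i - m) (c i)
  indep : ∀ g : Fin n → F, ∑ i, g i • coeffVec (x i) (L i) = 0 → ∑ i, g i * c i = 0 → g = 0

/-- A reduced basis such that `u · x i` has degree less than `L i - m` for all `i` but one. -/
structure IsAdapted (u : Fin n → RatFunc.CompletionAtInfty F) (m : ℕ) (x : Fin n → Fin n → F[X])
    (L : Fin n → ℕ) (k : Fin n) : Prop where
  span : Submodule.span F[X] (Set.range x) = ⊤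
  natDegree_le : ∀ i j, (x i j).natDegree ≤ L i
  v_lt : ∀ i, i ≠ k → Valued.v (dotInf u (x i)) < exp ((L i : ℤ) - m)
  v_eq : Valued.v (dotInf u (x k)) = exp ((L k : ℤ) - m)
  indep : ∀ g : Fin n → F, g k = 0 → ∑ i, g i • coeffVec (x i) (L i) = 0 → g = 0

variable {u : Fin n → RatFunc.CompletionAtInfty F} {m : ℕ} {x : Fin n → Fin n → F[X]}
  {L : Fin n → ℕ}

/-- Elements of equal level are interchangeable; this freedom serves to keep the levels sorted after
an increase. -/
theorem IsReduced.comp_perm {c : Fin n → F} (h : IsReduced u m x L c) (σ : Equiv.Perm (Fin n))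
    (hσ : ∀ i, L (σ i) = L i) : IsReduced u m (x ∘ σ) L (c ∘ σ) where
  span := by rw [σ.surjective.range_comp, h.span]
  natDegree_le i j := hσ i ▸ h.natDegree_le (σ i) j
  lead i := hσ i ▸ h.lead (σ i)
  indep g h1 h2 := by
    have := h.indep (g ∘ σ.symm) ?_ ?_
    · ext i
      simpa using congrFun this (σ i)
    · rw [← h1, ← Equiv.sum_comp σ]
      simp [hσ]
    · rw [← h2, ← Equiv.sum_comp σ]
      simp

/-- Subtracting multiples of `x k` from the other elements of a reduced basis, one gets an adapted
basis. -/
theorem IsReduced.exists_isAdapted {c : Fin n → F} (h : IsReduced u m x L c) {k : Fin n}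
    (hk : c k ≠ 0) (hL : ∀ i, c i ≠ 0 → L k ≤ L i) : ∃ x', IsAdapted u m x' L k := by
  -- Gaussian elimination with pivot `k`: the monomial of degree `L i - L k` brings `x k` to level
  -- `L i`. It is needed only when `c i ≠ 0`, where `L k ≤ L i` holds.
  let a : Fin n → F := fun i => if i = k then 0 else -(c i / c k)
  let p : Fin n → F[X] := fun i => C (a i) * X ^ (L i - L k)
  have hak : a k = 0 := by simp [a]
  have hac : ∀ i, i ≠ k → c i + a i * c k = 0 := fun i hi => by simp [a, hi, hk]
  have haL : ∀ i, a i ≠ 0 → L k ≤ L i := by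
    intro i hi
    refine hL i fun hc => hi ?_
    simp [a, hc]
  have hpk : p k = 0 := by simp [p, hak]
  have hpd : ∀ i, (p i).natDegree ≤ L i - L k := fun i => Polynomial.natDegree_C_mul_X_pow_le _ _
  have hpc : ∀ i, (p i).coeff (L i - L k) = a i := fun i => by simp [p]
  have hp0 : ∀ i, a i = 0 → p i = 0 := fun i hi => by simp [p, hi]
  have hlead : ∀ i, HasLead (dotInf u (x i + p i • x k)) (L i - m) (c i + a i * c k) := by
    intro i
    rw [dotInf_add, dotInf_smul]
    refine (h.lead i).add ?_
    by_cases hi : a i = 0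
    · simp [hp0 i hi, hi, HasLead.zero]
    · have h1 := (HasLead.polyInf (hpd i)).mul (h.lead k)
      rw [hpc] at h1
      convert! h1 using 1
      push_cast [haL i hi]
      ring
  have hcoeff : ∀ i, coeffVec (x i + p i • x k) (L i) =
      coeffVec (x i) (L i) + a i • coeffVec (x k) (L k) := by
    intro i
    ext j
    simp only [coeffVec, Pi.add_apply, Pi.smul_apply, smul_eq_mul, Polynomial.coeff_add]
    by_cases hi : a i = 0
    · simp [hp0 i hi, hi]
    · congr 1
      have := haL i hi
      rw [← hpc i]
      conv_lhs => rw [← Nat.sub_add_cancel this]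
      exact Polynomial.coeff_mul_add_eq_of_natDegree_le (hpd i) (h.natDegree_le k j)
  refine ⟨fun i => x i + p i • x k, ?_, ?_, ?_, ?_, ?_⟩
  · rw [eq_top_iff, ← h.span, Submodule.span_le]
    have hk' : x k ∈ Submodule.span F[X] (Set.range fun i => x i + p i • x k) :=
      Submodule.subset_span ⟨k, by simp [hpk]⟩
    rintro _ ⟨i, rfl⟩
    have hi : x i + p i • x k ∈ Submodule.span F[X] (Set.range fun i => x i + p i • x k) :=
      Submodule.subset_span ⟨i, rfl⟩
    simpa using Submodule.sub_mem _ hi (Submodule.smul_mem _ (p i) hk')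
  · intro i j
    by_cases hi : a i = 0
    · simpa [hp0 i hi] using h.natDegree_le i j
    · refine Polynomial.natDegree_add_le_of_degree_le (h.natDegree_le i j) ?_
      exact (Polynomial.natDegree_mul_le_of_le (hpd i) (h.natDegree_le k j)).trans_eq
        (Nat.sub_add_cancel (haL i hi))
  · intro i hi
    exact HasLead.zero_iff.1 (hac i hi ▸ hlead i)
  · have := hlead k
    rw [hak, zero_mul, add_zero] at this
    exact this.v_eq hk
  · intro g hgk hg
    simp only [hcoeff, smul_add, Finset.sum_add_distrib, smul_smul, ← Finset.sum_smul] at hg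
    -- A relation among the new top vectors is one among the old, with the multiples of `x k`
    -- collected at `k`. It also annihilates `c`, since the new coefficients `c i + a i * c k`
    -- vanish for `i ≠ k` and `g k = 0`.
    have hz := h.indep (g + Pi.single k (∑ i, g i * a i)) ?_ ?_
    · ext i
      by_cases hi : i = k
      · rw [hi, hgk]; rfl
      · simpa [hi] using congrFun hz i
    · simpa [add_smul, Finset.sum_add_distrib, Pi.single_apply, ite_smul] using hg
    · simp only [Pi.add_apply, add_mul, Finset.sum_add_distrib, Pi.single_apply, ite_mul, zero_mul,
        Finset.sum_ite_eq', Finset.mem_univ, if_true, Finset.sum_mul]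
      rw [← Finset.sum_add_distrib]
      refine Finset.sum_eq_zero fun i _ => ?_
      by_cases hi : i = k
      · simp [hi, hgk]
      · rw [mul_assoc, ← mul_add, hac i hi, mul_zero]

/-- Once its level has been raised, `x k` contributes nothing to the top coefficient vectors, so the
next perturbation of `u` cannot change `c k`. -/
theorem IsAdapted.coeffVec_eq_zero {k : Fin n} (h : IsAdapted u m x L k) :
    coeffVec (x k) (L k + 1) = 0 := by
  ext j
  exact Polynomial.coeff_eq_zero_of_natDegree_lt (Nat.lt_succ_of_le (h.natDegree_le k j))

/-- The new levels are increased by `1` at `k`. -/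
theorem IsAdapted.isReduced_succ {k : Fin n} (h : IsAdapted u m x L k) :
    ∃ c : Fin n → F, c k ≠ 0 ∧ IsReduced u (m + 1) x (L + Pi.single k 1) c := by
  have hv : ∀ i, Valued.v (dotInf u (x i)) ≤
      exp (((L + Pi.single k 1 : Fin n → ℕ) i : ℤ) - (m + 1 : ℕ)) := by
    intro i
    by_cases hi : i = k
    · subst hi
      rw [h.v_eq, WithZero.exp_le_exp]
      simp
    · refine ((v_lt_exp_iff _ _).1 (h.v_lt i hi)).trans ?_
      rw [WithZero.exp_le_exp]
      simp only [Pi.add_apply, Pi.single_apply, hi, if_false]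
      push_cast
      linarith
  choose c hc using fun i => HasLead.exists_of_v_le (hv i)
  have hck : c k ≠ 0 := by
    intro h0
    have h1 := hc k
    rw [h0, HasLead.zero_iff, h.v_eq, WithZero.exp_lt_exp] at h1
    simp at h1
  refine ⟨c, hck, h.span, fun i j => (h.natDegree_le i j).trans (Nat.le_add_right _ _), hc, ?_⟩
  intro g hg hgc
  -- The `k`-th top vector is now zero, so the first relation controls only the indices other than
  -- `k`; the second relation and `c k ≠ 0` then give `g k = 0`.
  have hz : Function.update g k 0 = 0 := by
    refine h.indep _ (by simp) ?_
    rw [← hg]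
    refine Finset.sum_congr rfl fun i _ => ?_
    by_cases hi : i = k
    · subst hi
      simp [h.coeffVec_eq_zero]
    · simp [hi]
  have hz' : ∀ i, i ≠ k → g i = 0 := fun i hi => by simpa [hi] using congrFun hz i
  rw [Finset.sum_eq_single k (fun i _ hi => by rw [hz' i hi, zero_mul]) (by simp)] at hgc
  ext i
  by_cases hi : i = k
  · subst hi
    simpa [hck] using hgc
  · exact hz' i hi

/-- The perturbation changes `u · x i` by an element of degree at most `L i - m - 1`, below the
degree that adaptedness tests. -/
theorem IsAdapted.congr {k : Fin n} (h : IsAdapted u m x L k)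
    {w : Fin n → RatFunc.CompletionAtInfty F} (hw : ∀ j, Valued.v (w j - u j) ≤ exp (-(m : ℤ) - 1)) :
    IsAdapted w m x L k := by
  have hd : ∀ i, Valued.v (dotInf (w - u) (x i)) < exp ((L i : ℤ) - m) := by
    intro i
    rw [v_lt_exp_iff]
    refine (v_dotInf_le hw (h.natDegree_le i)).trans ?_
    rw [WithZero.exp_le_exp]
    linarith
  have he : ∀ i, dotInf w (x i) = dotInf u (x i) + dotInf (w - u) (x i) := fun i => by
    rw [← dotInf_add_left, add_sub_cancel]
  refine ⟨h.span, h.natDegree_le, fun i hi => ?_, ?_, h.indep⟩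
  · rw [he]
    exact (Valuation.map_add _ _ _).trans_lt (max_lt (h.v_lt i hi) (hd i))
  · rw [he, ← h.v_eq]
    exact Valuation.map_add_eq_of_lt_left _ (h.v_eq ▸ hd k)

theorem exists_sum_mul_eq {E ι : Type*} [Field E] {v : ι → Fin n → E}
    (hv : LinearIndependent E v) (t : ι → E) : ∃ w : Fin n → E, ∀ i, ∑ j, w j * v i j = t i := by
  obtain ⟨f, hf⟩ := LinearMap.exists_extend
    ((Finsupp.linearCombination E t).comp hv.repr)
  refine ⟨fun j => f (Pi.single j 1), fun i => ?_⟩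
  have h1 : f (v i) = t i := by
    have := LinearMap.congr_fun hf ⟨v i, Submodule.subset_span ⟨i, rfl⟩⟩
    simpa [hv.repr_eq_single i ⟨v i, Submodule.subset_span ⟨i, rfl⟩⟩ rfl] using this
  rw [← h1, LinearMap.pi_apply_eq_sum_univ f (v i)]
  refine Finset.sum_congr rfl fun j _ => ?_
  have : (Pi.single j 1 : Fin n → E) = fun i => if j = i then 1 else 0 := by
    ext i
    simp [Pi.single_apply, eq_comm]
  rw [smul_eq_mul, mul_comm, ← this]

/-- The added coefficients are a linear function of the top vectors, so they satisfy every relation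
among these, and independence is preserved. -/
theorem IsReduced.add_lead {c : Fin n → F} (h : IsReduced u m x L c) (w : Fin n → F) :
    IsReduced (u + fun j => polyInf (C (w j)) * varInf ^ (-(m : ℤ))) m x L
      (fun i => c i + ∑ j, w j * coeffVec (x i) (L i) j) where
  span := h.span
  natDegree_le := h.natDegree_le
  lead i := by
    rw [dotInf_add_left]
    refine (h.lead i).add (HasLead.sum _ _ _ fun j _ => ?_)
    have h1 : HasLead (polyInf (C (w j)) * varInf ^ (-(m : ℤ))) (-(m : ℤ)) (w j) := by
      rw [HasLead, sub_self, map_zero]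
      exact WithZero.exp_pos
    have h2 := h1.mul (HasLead.polyInf (h.natDegree_le i j))
    rwa [neg_add_eq_sub] at h2
  indep g h1 h2 := by
    refine h.indep g h1 ?_
    rw [← h2]
    simp only [mul_add, Finset.sum_add_distrib, left_eq_add, Finset.mul_sum]
    rw [Finset.sum_comm]
    refine Finset.sum_eq_zero fun j _ => ?_
    have := congrFun h1 j
    simp only [Finset.sum_apply, Pi.smul_apply, smul_eq_mul, Pi.zero_apply] at this
    rw [← mul_zero (w j), ← this, Finset.mul_sum]
    exact Finset.sum_congr rfl fun i _ => by ring

/-- One can prescribe the place of the next increase, by modifying the coefficients of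
`T ^ (- m - 1)` in `u`. -/
theorem IsAdapted.exists_succ {k : Fin n} (h : IsAdapted u m x L k) (k' : Fin n)
    (hk : (L + Pi.single k 1 : Fin n → ℕ) k' ≤ (L + Pi.single k 1 : Fin n → ℕ) k) :
    ∃ (w : Fin n → RatFunc.CompletionAtInfty F) (x' : Fin n → Fin n → F[X]),
      (∀ j, Valued.v (w j - u j) ≤ exp (-(m : ℤ) - 1)) ∧
      IsAdapted w (m + 1) x' (L + Pi.single k 1) k' := by
  obtain ⟨c, hck, hc⟩ := h.isReduced_succ
  have hli : LinearIndependent F fun i : {i // i ≠ k} => coeffVec (x i) (L i) := by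
    rw [Fintype.linearIndependent_iff]
    intro g hg i
    have := h.indep (fun i => if hi : i = k then 0 else g ⟨i, hi⟩) (by simp) ?_
    · simpa [i.2] using congrFun this i
    · rw [← hg, ← Fintype.sum_subtype_add_sum_subtype (fun i => i ≠ k)]
      have h0 : ∀ i : {i // ¬ i ≠ k}, (i : Fin n) = k := fun i => not_not.1 i.2
      simp only [h0, dite_true, zero_smul, Finset.sum_const_zero, add_zero]
      exact Finset.sum_congr rfl fun i _ => by rw [dif_neg i.2]
  -- Chosen so that, away from `k`, the new leading coefficients are `1` at `k'` and `0` elsewhere;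
  -- the only possible competitor of `k'` as pivot is then `k`.
  obtain ⟨w, hw⟩ := exists_sum_mul_eq hli fun i => (if (i : Fin n) = k' then 1 else 0) - c i
  have hred := hc.add_lead w
  set c' : Fin n → F := fun i => c i +
    ∑ j, w j * coeffVec (x i) ((L + Pi.single k 1 : Fin n → ℕ) i) j with hc'
  have hk1 : c' k = c k := by simp [hc', h.coeffVec_eq_zero]
  have hk2 : ∀ i, i ≠ k → c' i = if i = k' then 1 else 0 := by
    intro i hi
    have := hw ⟨i, hi⟩
    simp [hc', hi, this]
  have hk3 : c' k' ≠ 0 := by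
    by_cases hkk : k' = k
    · rw [hkk, hk1]; exact hck
    · simp [hk2 k' hkk]
  obtain ⟨x', hx'⟩ := hred.exists_isAdapted hk3 fun i hi => by
    by_cases hik : i = k
    · rw [hik]; exact hk
    · rw [hk2 i hik] at hi
      by_cases hik' : i = k'
      · rw [hik']
      · simp [hik'] at hi
  refine ⟨_, x', fun j => ?_, hx'⟩
  rw [Pi.add_apply, add_sub_cancel_left]
  refine (v_C_mul_varInf_zpow_le _ _).trans ?_
  rw [WithZero.exp_le_exp]
  push_cast
  linarith

theorem IsReduced.exists_isAdapted_monotone {c : Fin n → F} (h : IsReduced u m x L c)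
    (hL : Monotone L) (hc : ∃ i, c i ≠ 0) :
    ∃ x' k, IsAdapted u m x' L k ∧ Monotone (L + Pi.single k 1) ∧ ∀ i, c i ≠ 0 → L k ≤ L i := by
  classical
  obtain ⟨j, hj, hjmin⟩ := Finset.exists_min_image (Finset.univ.filter fun i => c i ≠ 0) L
    (by simpa [Finset.filter_nonempty_iff] using hc)
  -- The last index of the block of equal levels: adding `1` there keeps the levels nondecreasing.
  obtain ⟨k, hk, hkmax⟩ := Finset.exists_max_image (Finset.univ.filter fun i => L i = L j) id
    ⟨j, by simp⟩
  simp only [Finset.mem_filter, Finset.mem_univ, true_and, id] at hj hjmin hk hkmax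
  have hσ : ∀ i, L (Equiv.swap k j i) = L i := by
    intro i
    rw [Equiv.swap_apply_def]
    split_ifs with h1 h2
    · rw [h1, hk]
    · rw [h2, hk]
    · rfl
  have hred := h.comp_perm (Equiv.swap k j) hσ
  obtain ⟨x', hx'⟩ := hred.exists_isAdapted (k := k) (by simpa using hj) fun i hi => by
    rw [hk, ← hσ i]
    exact hjmin _ hi
  refine ⟨x', k, hx', fun a b hab => ?_, fun i hi => hk ▸ hjmin i hi⟩
  have h1 := hL hab
  simp only [Pi.add_apply, Pi.single_apply]
  split_ifs with ha hb hb
  · omega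
  · subst ha
    have : L b ≠ L a := fun he => hb (le_antisymm (hkmax b (he.trans hk)) hab)
    omega
  · omega
  · omega

end Bases

/-! ### Minima read off from an adapted basis. -/

section Minima

variable {F : Type*} [Field F] [DecidableEq (RatFunc F)] {n : ℕ}
variable {u : Fin n → RatFunc.CompletionAtInfty F} {m : ℕ} {x : Fin n → Fin n → F[X]}
  {L : Fin n → ℕ} {k : Fin n}

theorem IsAdapted.exists_lead (h : IsAdapted u m x L k) : ∃ c : F, c ≠ 0 ∧
    ∀ i, HasLead (dotInf u (x i)) (L i - m) ((Pi.single k c : Fin n → F) i) := by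
  obtain ⟨c, hc⟩ := HasLead.exists_of_v_le h.v_eq.le
  refine ⟨c, fun h0 => ?_, fun i => ?_⟩
  · rw [h0, HasLead.zero_iff, h.v_eq] at hc
    exact lt_irrefl _ hc
  · by_cases hi : i = k
    · subst hi
      simpa using hc
    · simpa [hi, HasLead.zero_iff] using h.v_lt i hi

theorem mem_solutions_iff (q t : ℝ) (y : Fin n → F[X]) : y ∈ solutions u q t ↔
    (∀ j, Valued.v (polyInf (y j)) ≤ exp ⌊t⌋) ∧ Valued.v (dotInf u y) ≤ exp ⌊t - q⌋ := by
  rw [← absInf_le_exp_iff]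
  simp only [← absInf_le_exp_iff]
  exact and_congr (supNorm_le_iff _ (Real.exp_nonneg _)) Iff.rfl

/-- The trajectory of the `i`-th element of an adapted basis. -/
def level (m : ℕ) (L : Fin n → ℕ) (k : Fin n) (q : ℝ) (i : Fin n) : ℝ :=
  L i + (q - m) * (Pi.single k 1 : Fin n → ℝ) i

theorem level_of_ne {i : Fin n} (hi : i ≠ k) (q : ℝ) : level m L k q i = L i := by
  simp [level, hi]

theorem level_self (q : ℝ) : level m L k q k = L k + (q - m) := by
  simp [level]

/-- For `i ≠ k` the strict bound on `u · x i` leaves one unit of slack, which suffices as long as `q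
≤ m + 1`. -/
theorem IsAdapted.mem_solutions (h : IsAdapted u m x L k) {q : ℝ} (hq : (m : ℝ) ≤ q)
    (hq' : q ≤ m + 1) {t : ℝ} {i : Fin n} (ht : level m L k q i ≤ t) : x i ∈ solutions u q t := by
  rw [mem_solutions_iff]
  by_cases hi : i = k
  · subst hi
    rw [level_self] at ht
    constructor
    · intro j
      refine ((v_polyInf_le _ _).2 (h.natDegree_le i j)).trans ?_
      rw [WithZero.exp_le_exp, Int.le_floor]
      push_cast
      linarith
    · rw [h.v_eq, WithZero.exp_le_exp, Int.le_floor]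
      push_cast
      linarith
  · rw [level_of_ne hi] at ht
    constructor
    · intro j
      refine ((v_polyInf_le _ _).2 (h.natDegree_le i j)).trans ?_
      rw [WithZero.exp_le_exp, Int.le_floor]
      exact_mod_cast ht
    · refine ((v_lt_exp_iff _ _).1 (h.v_lt i hi)).trans ?_
      rw [WithZero.exp_le_exp, Int.le_floor]
      push_cast
      linarith

/-- No cancellation: the part of highest degree `D` survives either in the coordinates or in the
product with `u`, so a solution involves only basis elements of level at most `t`. -/
theorem IsAdapted.level_le (h : IsAdapted u m x L k) {q : ℝ} (hq : (m : ℝ) ≤ q)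
    (hq' : q ≤ m + 1) {t : ℝ} {d : Fin n → F[X]} (hd : ∑ i, d i • x i ∈ solutions u q t)
    {i : Fin n} (hi : d i ≠ 0) : level m L k q i ≤ t := by
  classical
  obtain ⟨i₀, hi₀, hmax⟩ := Finset.exists_max_image (Finset.univ.filter fun i => d i ≠ 0)
    (fun i => (d i).natDegree + L i) ⟨i, by simpa using hi⟩
  simp only [Finset.mem_filter, Finset.mem_univ, true_and] at hi₀ hmax
  set D := (d i₀).natDegree + L i₀ with hD
  -- These are the leading coefficients of the `d i` for which `deg (d i) + L i` attains `D`, and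
  -- `0` for the others.
  set e : Fin n → F := fun i => (d i).coeff (D - L i) with he
  rw [mem_solutions_iff] at hd
  have hdeg : ∀ i, (d i).natDegree ≤ D - L i := by
    intro i
    by_cases hi : d i = 0
    · simp [hi]
    · have := hmax i hi
      omega
  have hLD : ∀ i, d i ≠ 0 → L i ≤ D := fun i hi => (Nat.le_add_left _ _).trans (hmax i hi)
  -- If `e k = 0`, independence gives `‖∑ d i • x i‖ ≥ e ^ D`. Otherwise the product with `u` has
  -- degree exactly `D - m`, whence `D + (q - m) ≤ t`.
  by_cases hek : e k = 0
  · have hei : e i₀ ≠ 0 := by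
      have : D - L i₀ = (d i₀).natDegree := by omega
      simp [he, this, hi₀]
    have hcoeff : coeffVec (∑ i, d i • x i) D = ∑ i, e i • coeffVec (x i) (L i) := by
      ext j
      simp only [coeffVec, Finset.sum_apply, Pi.smul_apply, smul_eq_mul, Polynomial.finsetSum_coeff]
      refine Finset.sum_congr rfl fun i _ => ?_
      by_cases hi : d i = 0
      · simp [he, hi]
      · conv_lhs => rw [← Nat.sub_add_cancel (hLD i hi)]
        exact Polynomial.coeff_mul_add_eq_of_natDegree_le (hdeg i) (h.natDegree_le i j)
    have hne : coeffVec (∑ i, d i • x i) D ≠ 0 := by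
      intro h0
      rw [hcoeff] at h0
      exact hei (congrFun (h.indep e hek h0) i₀)
    obtain ⟨j, hj⟩ := Function.ne_iff.1 hne
    have hDt : (D : ℝ) ≤ t := by
      have h1 := hd.1 j
      have h2 : (∑ i, d i • x i) j ≠ 0 := fun h0 => hj (by simp [coeffVec, h0])
      rw [v_polyInf h2, WithZero.exp_le_exp, Int.le_floor] at h1
      refine le_trans ?_ h1
      exact_mod_cast Polynomial.le_natDegree_of_ne_zero hj
    by_cases hik : i = k
    · subst hik
      -- Since `x k` does not attain `D`, its level is at least one less, which absorbs `q - m ≤ 1`.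
      have h1 : L i < D := by
        refine lt_of_le_of_ne (hLD i hi) fun h0 => ?_
        have h2 := hmax i hi
        have h3 : D - L i = (d i).natDegree := by omega
        rw [he] at hek
        simp only [h3, Polynomial.coeff_natDegree, Polynomial.leadingCoeff_eq_zero] at hek
        exact hi hek
      have h2 : (L i : ℝ) + 1 ≤ D := by exact_mod_cast h1
      rw [level_self]
      linarith
    · rw [level_of_ne hik]
      exact le_trans (by exact_mod_cast hLD i hi) hDt
  · obtain ⟨c, hc0, hc⟩ := h.exists_lead
    have hlead : HasLead (dotInf u (∑ i, d i • x i)) (D - m)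
        (∑ i, e i * (Pi.single k c : Fin n → F) i) := by
      rw [dotInf_sum]
      refine HasLead.sum _ _ _ fun i _ => ?_
      rw [dotInf_smul]
      by_cases hi : d i = 0
      · simp [he, hi, HasLead.zero]
      · have h1 := (HasLead.polyInf (hdeg i)).mul (hc i)
        convert! h1 using 1
        push_cast [hLD i hi]
        ring
    have hs : ∑ i, e i * (Pi.single k c : Fin n → F) i = e k * c := by
      rw [Finset.sum_eq_single k (fun i _ hi => by simp [hi]) (by simp)]
      simp
    have h1 := hd.2
    rw [hlead.v_eq (hs ▸ mul_ne_zero hek hc0), WithZero.exp_le_exp, Int.le_floor] at h1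
    push_cast at h1
    have h2 : (L i : ℝ) ≤ D := by exact_mod_cast hLD i hi
    by_cases hik : i = k
    · subst hik
      rw [level_self]
      linarith
    · rw [level_of_ne hik]
      linarith

theorem toRat_sum_smul {E : Type*} [Field E] (d : Fin n → E[X]) (x : Fin n → Fin n → E[X]) :
    toRat (∑ i, d i • x i) = ∑ i, algebraMap E[X] (RatFunc E) (d i) • toRat (x i) := by
  ext j
  simp only [toRat, Finset.sum_apply, Pi.smul_apply, smul_eq_mul, map_sum, map_mul]

theorem linearIndependent_toRat {E : Type*} [Field E] {x : Fin n → Fin n → E[X]}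
    (h : Submodule.span E[X] (Set.range x) = ⊤) :
    LinearIndependent (RatFunc E) fun i => toRat (x i) := by
  refine linearIndependent_of_top_le_span_of_card_eq_finrank ?_ (by simp)
  rw [← (Pi.basisFun (RatFunc E) (Fin n)).span_eq, Submodule.span_le]
  rintro _ ⟨j, rfl⟩
  obtain ⟨d, hd⟩ := (Submodule.mem_span_range_iff_exists_fun E[X]).1
    (h ▸ Submodule.mem_top : (Pi.single j 1 : Fin n → E[X]) ∈ Submodule.span E[X] (Set.range x))
  rw [Pi.basisFun_apply, ← toRat_single, ← hd, toRat_sum_smul]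
  exact Submodule.sum_mem _ fun i _ =>
    Submodule.smul_mem _ _ (Submodule.subset_span ⟨i, rfl⟩)

/-- An adapted basis gives the minima on an interval of length one. -/
theorem IsAdapted.logMinima_eq (h : IsAdapted u m x L k) {q : ℝ≥0} (hq : (m : ℝ) ≤ q)
    (hq' : (q : ℝ) ≤ m + 1) (hmono : Monotone (level m L k q)) :
    logMinima u q = level m L k q := by
  ext i
  refine IsLeast.csInf_eq ⟨⟨?_, ?_⟩, fun t ht => ?_⟩
  · by_cases hi : i = k
    · subst hi
      rw [level_self]
      have : (0 : ℝ) ≤ L i := Nat.cast_nonneg _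
      linarith
    · rw [level_of_ne hi]
      exact Nat.cast_nonneg _
  · have h1 : LinearIndependent (RatFunc F) fun j : Set.Iic i => toRat (x j) :=
      (linearIndependent_toRat h.span).comp _ Subtype.val_injective
    have h2 := finrank_span_eq_card h1
    rw [Fintype.card_ofFinset (Finset.Iic i) (by simp), Fin.card_Iic] at h2
    rw [← h2]
    refine Submodule.finrank_mono (Submodule.span_mono ?_)
    rintro _ ⟨j, rfl⟩
    exact ⟨_, h.mem_solutions hq hq' (hmono j.2), rfl⟩
  · by_contra hlt
    rw [not_le] at hlt
    -- Below the `i`-th level, solutions involve only the basis elements of index less than `i`,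
    -- which are too few.
    have h1 : Submodule.span (RatFunc F) (toRat '' solutions u q t) ≤
        Submodule.span (RatFunc F) (Set.range fun j : Set.Iio i => toRat (x j)) := by
      rw [Submodule.span_le]
      rintro _ ⟨y, hy, rfl⟩
      obtain ⟨d, rfl⟩ := (Submodule.mem_span_range_iff_exists_fun F[X]).1
        (h.span ▸ Submodule.mem_top : y ∈ Submodule.span F[X] (Set.range x))
      rw [toRat_sum_smul]
      refine Submodule.sum_mem _ fun j _ => ?_
      by_cases hj : j < i
      · exact Submodule.smul_mem _ _ (Submodule.subset_span ⟨⟨j, hj⟩, rfl⟩)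
      · have hd : d j = 0 := by
          by_contra hd
          exact absurd ((hmono (not_lt.1 hj)).trans (h.level_le hq hq' hy hd)) hlt.not_ge
        simp [hd]
    have h2 := ht.2.trans ((Submodule.finrank_mono h1).trans (finrank_range_le_card _))
    rw [Fintype.card_ofFinset (Finset.Iio i) (by simp), Fin.card_Iio] at h2
    omega

/-- The canonical basis is reduced for the maximum norm. -/
theorem isReduced_single {c : Fin n → F} (hc : ∀ j, HasLead (u j) 0 (c j)) :
    IsReduced u 0 (fun i => Pi.single i 1) 0 c where
  span := by
    rw [← (Pi.basisFun F[X] (Fin n)).span_eq]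
    congr 2
    ext i : 1
    rw [Pi.basisFun_apply]
  natDegree_le i j := by
    rw [Pi.single_apply]
    split_ifs <;> simp
  lead i := by
    have : dotInf u (Pi.single i 1 : Fin n → F[X]) = u i := by
      simp [dotInf, Pi.single_apply, apply_ite]
    rw [this]
    simpa using hc i
  indep g hg _ := by
    ext j
    have := congrFun hg j
    simpa [coeffVec, Pi.single_apply, apply_ite, ite_apply, Polynomial.coeff_one] using this

/-- The starting point of the construction of `u`: all levels are zero and the first increase may be
at any place. -/
theorem exists_isAdapted_single (k : Fin n) :
    ∃ x, IsAdapted (Pi.single k 1 : Fin n → RatFunc.CompletionAtInfty F) 0 x 0 k := by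
  refine (isReduced_single (c := Pi.single k 1) fun j => ?_).exists_isAdapted (by simp) (by simp)
  have : (Pi.single k 1 : Fin n → RatFunc.CompletionAtInfty F) j =
      polyInf (Polynomial.C ((Pi.single k 1 : Fin n → F) j)) := by
    by_cases hj : j = k
    · subst hj
      simp
    · simp [hj]
  rw [this]
  simp [HasLead]

theorem supNorm_eq_one_iff (u : Fin n → RatFunc.CompletionAtInfty F) :
    supNorm u = 1 ↔ (∀ j, Valued.v (u j) ≤ 1) ∧ ∃ j, Valued.v (u j) = 1 := by
  have hle : supNorm u ≤ 1 ↔ ∀ j, Valued.v (u j) ≤ 1 := by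
    rw [supNorm_le_iff u zero_le_one]
    refine forall_congr' fun j => ?_
    simpa using absInf_le_exp_iff (u j) 0
  -- The value group is discrete: below `1`, the next value is `e ^ (-1)`.
  have hlt : supNorm u ≤ Real.exp (-1) ↔ ∀ j, Valued.v (u j) < 1 := by
    rw [supNorm_le_iff u (Real.exp_nonneg _)]
    refine forall_congr' fun j => ?_
    have h1 := absInf_le_exp_iff (u j) (-1)
    have h2 := v_lt_exp_iff (u j) 0
    rw [WithZero.exp_zero] at h2
    have h3 : ⌊(-1 : ℝ)⌋ = 0 - 1 := by norm_num
    rw [h2, h1, h3]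
  have h1 : Real.exp (-1) < 1 := (Real.exp_lt_exp.2 (by norm_num)).trans_eq Real.exp_zero
  constructor
  · intro h
    refine ⟨hle.1 h.le, ?_⟩
    by_contra! hne
    have := hlt.2 fun j => lt_of_le_of_ne (hle.1 h.le j) (hne j)
    linarith
  · rintro ⟨h, j, hj⟩
    refine le_antisymm (hle.2 h) ?_
    have h2 : absInf (u j) = 1 := by
      have h3 : u j ≠ 0 := by
        rintro h0
        rw [h0, map_zero] at hj
        exact zero_ne_one hj
      simp [absInf, h3, hj]
    rw [← h2]
    exact le_ciSup (Set.finite_range fun i => absInf (u i)).bddAbove j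

end Minima

/-! ### Integral `n`-systems as discrete paths. -/

section Systems

variable {n : ℕ}

/-- The values `L m` at the integers `m` of an integral `n`-system, together with the indices `k m`
of the components that increase between `m` and `m + 1`. -/
structure IsDiscreteSystem (L : ℕ → Fin n → ℕ) (k : ℕ → Fin n) : Prop where
  zero : L 0 = 0
  succ : ∀ m, L (m + 1) = L m + Pi.single (k m) 1
  mono : ∀ m, Monotone (L m)
  le : ∀ m, L (m + 1) (k (m + 1)) ≤ L (m + 1) (k m)

/-- `P` interpolates linearly the values of `L`. -/
def Interpolates (P : ℝ≥0 → Fin n → ℝ) (L : ℕ → Fin n → ℕ) (k : ℕ → Fin n) : Prop :=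
  ∀ (m : ℕ) (q : ℝ≥0), (m : ℝ) ≤ q → (q : ℝ) ≤ m + 1 → P q = level m (L m) (k m) q

variable {P : ℝ≥0 → Fin n → ℝ} {L : ℕ → Fin n → ℕ} {k : ℕ → Fin n}

theorem exists_nat_le_lt (q : ℝ≥0) : ∃ m : ℕ, (m : ℝ) ≤ q ∧ (q : ℝ) < m + 1 :=
  ⟨⌊q⌋₊, by exact_mod_cast Nat.floor_le q.2, by exact_mod_cast Nat.lt_floor_add_one q⟩

theorem Interpolates.eq {Q : ℝ≥0 → Fin n → ℝ} (hP : Interpolates P L k)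
    (hQ : Interpolates Q L k) : P = Q := by
  ext1 q
  obtain ⟨m, h1, h2⟩ := exists_nat_le_lt q
  rw [hP m q h1 h2.le, hQ m q h1 h2.le]

theorem Interpolates.apply_natCast (hP : Interpolates P L k) (m : ℕ) (i : Fin n) :
    P m i = L m i := by
  rw [hP m m (by simp) (by simp)]
  simp [level]

theorem level_eq_add (m : ℕ) (L : Fin n → ℕ) (k : Fin n) (q t : ℝ) :
    level m L k t = level m L k q + (t - q) • (Pi.single k 1 : Fin n → ℝ) := by
  ext i
  simp only [level, Pi.add_apply, Pi.smul_apply, smul_eq_mul]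
  ring

theorem IsDiscreteSystem.monotone_level (h : IsDiscreteSystem L k) {m : ℕ} {q : ℝ}
    (hq : (m : ℝ) ≤ q) (hq' : q ≤ m + 1) : Monotone (level m (L m) (k m) q) := by
  intro i j hij
  have h1 : (L m i : ℝ) ≤ L m j := by exact_mod_cast h.mono m hij
  have h2 : (L (m + 1) i : ℝ) ≤ L (m + 1) j := by exact_mod_cast h.mono (m + 1) hij
  have h3 : ∀ i, (L (m + 1) i : ℝ) = L m i + (Pi.single (k m) 1 : Fin n → ℝ) i := by
    intro i
    rw [h.succ, Pi.add_apply, Pi.single_apply, Pi.single_apply]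
    split_ifs <;> simp
  rw [h3, h3] at h2
  simp only [level]
  -- For `q` in `[m, m + 1]` the levels are a convex combination of `L m` and `L (m + 1)`, both
  -- nondecreasing.
  nlinarith

theorem IsDiscreteSystem.sum_eq (h : IsDiscreteSystem L k) (m : ℕ) : ∑ i, L m i = m := by
  induction m with
  | zero => simp [h.zero]
  | succ m ih => simp [h.succ, Finset.sum_add_distrib, ih]

/-- Slopes can change only at integers. There, if `k m < k (m + 1)`, the field `le` and the ordering
of the components squeeze all those in between to one value. -/
theorem IsDiscreteSystem.isNSystem (h : IsDiscreteSystem L k) (hP : Interpolates P L k) :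
    IsNSystem P where
  nonneg q i := by
    obtain ⟨m, h1, h2⟩ := exists_nat_le_lt q
    rw [hP m q h1 h2.le]
    have : (0 : ℝ) ≤ (Pi.single (k m) 1 : Fin n → ℝ) i :=
      (Pi.single_nonneg.2 zero_le_one : (0 : Fin n → ℝ) ≤ Pi.single (k m) 1) i
    have : 0 ≤ (q : ℝ) - m := by linarith
    rw [level]
    positivity
  mono q := by
    obtain ⟨m, h1, h2⟩ := exists_nat_le_lt q
    rw [hP m q h1 h2.le]
    exact h.monotone_level h1 h2.le
  sum_eq q := by
    obtain ⟨m, h1, h2⟩ := exists_nat_le_lt q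
    rw [hP m q h1 h2.le]
    simp only [level, Finset.sum_add_distrib, ← Finset.mul_sum]
    have : ∑ i, (L m i : ℝ) = m := by exact_mod_cast h.sum_eq m
    rw [this]
    simp
  slopes q := by
    have key : ∀ (m : ℕ) (t : ℝ≥0), (m : ℝ) ≤ q → (q : ℝ) ≤ m + 1 → (m : ℝ) ≤ t →
        (t : ℝ) ≤ m + 1 → P t = P q + ((t : ℝ) - q) • (Pi.single (k m) 1 : Fin n → ℝ) := by
      intro m t h1 h2 h3 h4
      rw [hP m q h1 h2, hP m t h3 h4]
      exact level_eq_add _ _ _ _ _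
    obtain ⟨m, h1, h2⟩ := exists_nat_le_lt q
    rcases h1.lt_or_eq with h1' | h1'
    · refine ⟨min (q - m) (m + 1 - q), lt_min (by linarith) (by linarith), k m, k m,
        fun t ht ht' => ?_, fun t ht ht' => ?_, fun _ hlt => absurd hlt (lt_irrefl _)⟩
      · have := min_le_left ((q : ℝ) - m) (m + 1 - q)
        have h3 : (t : ℝ) ≤ q := ht'
        exact key m t h1 h2.le (by linarith) (by linarith)
      · have := min_le_right ((q : ℝ) - m) (m + 1 - q)
        have h3 : (q : ℝ) ≤ t := ht
        exact key m t h1 h2.le (by linarith) (by linarith)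
    · have hright : ∀ t : ℝ≥0, q ≤ t → (t : ℝ) ≤ q + 1 →
          P t = P q + ((t : ℝ) - q) • (Pi.single (k m) 1 : Fin n → ℝ) := by
        intro t ht ht'
        have h3 : (q : ℝ) ≤ t := ht
        exact key m t h1 h2.le (by linarith) (by linarith)
      rcases m with _ | m
      · refine ⟨1, one_pos, k 0, k 0, fun t _ ht => ?_, hright,
          fun _ hlt => absurd hlt (lt_irrefl _)⟩
        have hq : q = 0 := by ext; simpa using h1'.symm
        have ht0 : t = q := le_antisymm ht (by simp [hq])
        simp [ht0]
      · push_cast at h1'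
        refine ⟨1, one_pos, k (m + 1), k m, fun t ht ht' => ?_, hright, fun _ hlt j hj hj' => ?_⟩
        · have h3 : (t : ℝ) ≤ q := ht'
          exact key m t (by linarith) (by linarith) (by linarith) (by linarith)
        · have hq : q = ((m + 1 : ℕ) : ℝ≥0) := by ext; push_cast; exact h1'.symm
          rw [hq, hP.apply_natCast, hP.apply_natCast, Nat.cast_inj]
          exact le_antisymm ((h.mono _ hj').trans (h.le m)) (h.mono _ hj)

/-- Continuous induction: the supremum of the points of `[a, b]` where `f` is at least `f a` is
again such a point, and cannot be less than `b`. -/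
theorem monotone_of_locally {f : ℝ≥0 → ℝ} (hf : ∀ q : ℝ≥0, ∃ ε : ℝ, 0 < ε ∧
    (∀ t : ℝ≥0, (q : ℝ) - ε ≤ t → t ≤ q → f t ≤ f q) ∧
    (∀ t : ℝ≥0, q ≤ t → (t : ℝ) ≤ q + ε → f q ≤ f t)) : Monotone f := by
  intro a b hab
  set S : Set ℝ≥0 := {t | t ∈ Set.Icc a b ∧ f a ≤ f t} with hS
  have ha : a ∈ S := ⟨⟨le_rfl, hab⟩, le_rfl⟩
  have hbd : BddAbove S := ⟨b, fun t ht => ht.1.2⟩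
  obtain ⟨ε, hε, hl, hr⟩ := hf (sSup S)
  have hac : a ≤ sSup S := le_csSup hbd ha
  have hcb : sSup S ≤ b := csSup_le ⟨a, ha⟩ fun t ht => ht.1.2
  have hfc : f a ≤ f (sSup S) := by
    by_cases h0 : sSup S = 0
    · have : a = sSup S := le_antisymm hac (by simp [h0])
      rw [← this]
    · have hpos : 0 < sSup S := pos_iff_ne_zero.2 h0
      have hlt : sSup S - ε.toNNReal < sSup S := tsub_lt_self hpos (Real.toNNReal_pos.2 hε)
      obtain ⟨t, ht, hlt'⟩ := exists_lt_of_lt_csSup ⟨a, ha⟩ hlt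
      refine ht.2.trans (hl t ?_ (le_csSup hbd ht))
      have h1 : sSup S ≤ t + ε.toNNReal := tsub_le_iff_right.1 hlt'.le
      have h2 : ((sSup S : ℝ≥0) : ℝ) ≤ t + ε.toNNReal := h1
      rw [Real.coe_toNNReal ε hε.le] at h2
      linarith
  rcases hcb.lt_or_eq with hlt | heq
  · exfalso
    set t := min b (sSup S + ε.toNNReal) with ht
    have h1 : sSup S < t := lt_min hlt (lt_add_of_pos_right _ (Real.toNNReal_pos.2 hε))
    have h2 : (t : ℝ) ≤ sSup S + ε := by
      have : t ≤ sSup S + ε.toNNReal := min_le_right _ _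
      have h3 : (t : ℝ) ≤ (sSup S : ℝ≥0) + ε.toNNReal := this
      rwa [Real.coe_toNNReal ε hε.le] at h3
    have h3 : t ∈ S := ⟨⟨hac.trans h1.le, min_le_left _ _⟩, hfc.trans (hr t h1.le h2)⟩
    exact absurd (le_csSup hbd h3) h1.not_ge
  · rwa [heq] at hfc

theorem IsNSystem.monotone_apply (h : IsNSystem P) (i : Fin n) : Monotone fun q => P q i := by
  refine monotone_of_locally fun q => ?_
  obtain ⟨ε, hε, k, l, hl, hk, -⟩ := h.slopes q
  have hs : ∀ k : Fin n, 0 ≤ (Pi.single k 1 : Fin n → ℝ) i := fun k =>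
    (Pi.single_nonneg.2 zero_le_one : (0 : Fin n → ℝ) ≤ Pi.single k 1) i
  refine ⟨ε, hε, fun t ht ht' => ?_, fun t ht ht' => ?_⟩
  · have h1 : (t : ℝ) - q ≤ 0 := sub_nonpos.2 ht'
    simp only [hl t ht ht', Pi.add_apply, Pi.smul_apply, smul_eq_mul]
    nlinarith [hs l]
  · have h1 : 0 ≤ (t : ℝ) - q := sub_nonneg.2 ht
    simp only [hk t ht ht', Pi.add_apply, Pi.smul_apply, smul_eq_mul]
    nlinarith [hs k]

theorem exists_eq_add_single {f g : Fin n → ℕ} (hfg : f ≤ g) (hs : ∑ i, g i = ∑ i, f i + 1) :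
    ∃ k, g = f + Pi.single k 1 := by
  obtain ⟨k, -, hk⟩ := Finset.exists_lt_of_sum_lt (f := f) (g := g) (s := Finset.univ) (by omega)
  have hle : ∀ i ∈ Finset.univ, (f + Pi.single k 1 : Fin n → ℕ) i ≤ g i := by
    intro i _
    by_cases hi : i = k
    · subst hi
      simpa using hk
    · simpa [hi] using hfg i
  refine ⟨k, funext fun i => ((Finset.sum_eq_sum_iff_of_le hle).1 ?_ i (Finset.mem_univ i)).symm⟩
  simp [Finset.sum_add_distrib, hs]

theorem single_eq_of_smul_eq {k l : Fin n} {v : Fin n → ℝ} {s : ℝ} (hs : s ≠ 0)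
    (h : v + s • (Pi.single k 1 : Fin n → ℝ) = v + s • (Pi.single l 1 : Fin n → ℝ)) : k = l := by
  have h1 := smul_right_injective (Fin n → ℝ) hs (add_left_cancel h)
  by_contra hkl
  have := congrFun h1 k
  simp [hkl] at this

/-- An `n`-system with integral values at the integers is linear between them. -/
theorem IsNSystem.exists_isDiscreteSystem (h : IsNSystem P)
    (hint : ∀ (m : ℕ) (i : Fin n), ∃ z : ℤ, P (m : ℝ≥0) i = (z : ℝ)) :
    ∃ L k, IsDiscreteSystem L k ∧ Interpolates P L k := by
  have hnat : ∀ (m : ℕ) (i : Fin n), ∃ z : ℕ, P (m : ℝ≥0) i = z := by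
    intro m i
    obtain ⟨z, hz⟩ := hint m i
    have h0 := h.nonneg m i
    rw [hz] at h0
    obtain ⟨w, rfl⟩ := Int.eq_ofNat_of_zero_le (Int.cast_nonneg_iff.1 h0)
    exact ⟨w, by simpa using hz⟩
  choose L hL using hnat
  have hsum : ∀ m, ∑ i, L m i = m := by
    intro m
    have := h.sum_eq m
    simp only [hL] at this
    exact_mod_cast this
  have hle : ∀ m, L m ≤ L (m + 1) := by
    intro m i
    have := h.monotone_apply i (show (m : ℝ≥0) ≤ ((m + 1 : ℕ) : ℝ≥0) by simp)
    simp only [hL] at this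
    exact_mod_cast this
  have hstep : ∀ m, ∃ k, L (m + 1) = L m + Pi.single k 1 :=
    fun m => exists_eq_add_single (hle m) (by rw [hsum, hsum])
  choose k hk using hstep
  have hinterp : Interpolates P L k := by
    intro m q h1 h2
    -- A nondecreasing component with equal values at both ends is constant; the sum condition then
    -- determines the remaining one.
    have hne : ∀ i, i ≠ k m → P q i = L m i := by
      intro i hi
      have h3 := h.monotone_apply i (show (m : ℝ≥0) ≤ q from h1)
      have h4 := h.monotone_apply i (show q ≤ ((m + 1 : ℕ) : ℝ≥0) by
        rw [← NNReal.coe_le_coe]; push_cast; exact h2)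
      simp only [hL, hk] at h3 h4
      simp only [Pi.add_apply, Pi.single_apply, hi, if_false, add_zero] at h4
      exact le_antisymm h4 h3
    have hlev : ∑ i, level m (L m) (k m) q i = q := by
      simp only [level, Finset.sum_add_distrib, ← Finset.mul_sum]
      have : ∑ i, (L m i : ℝ) = m := by exact_mod_cast hsum m
      rw [this]
      simp
    have hPs := h.sum_eq q
    rw [← hlev, ← Finset.add_sum_erase _ _ (Finset.mem_univ (k m)),
      ← Finset.add_sum_erase _ _ (Finset.mem_univ (k m))] at hPs
    have hrest : ∑ i ∈ Finset.univ.erase (k m), P q i =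
        ∑ i ∈ Finset.univ.erase (k m), level m (L m) (k m) q i := by
      refine Finset.sum_congr rfl fun i hi => ?_
      rw [hne i (Finset.ne_of_mem_erase hi), level_of_ne (Finset.ne_of_mem_erase hi)]
    ext i
    by_cases hi : i = k m
    · rw [hi]
      linarith
    · rw [hne i hi, level_of_ne hi]
  have hmono : ∀ m, Monotone (L m) := by
    intro m i j hij
    have := h.mono m hij
    rw [hL, hL] at this
    exact_mod_cast this
  refine ⟨L, k, ⟨?_, hk, hmono, fun m => ?_⟩, hinterp⟩
  · ext i
    exact (Finset.sum_eq_zero_iff.1 (hsum 0)) i (Finset.mem_univ i)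
  · obtain ⟨ε, hε, k', l', hl', hk', hS⟩ := h.slopes ((m + 1 : ℕ) : ℝ≥0)
    set q : ℝ≥0 := ((m + 1 : ℕ) : ℝ≥0) with hq
    have hqr : (q : ℝ) = m + 1 := by rw [hq]; push_cast; rfl
    -- Points at distance `δ` from `q` lie both in the range of (S2) and in the adjacent unit
    -- intervals, so the indices of (S2) can be compared with `k m` and `k (m + 1)`.
    set δ := min ε 1 with hδ
    have hδ0 : 0 < δ := lt_min hε one_pos
    have hδε : δ ≤ ε := min_le_left _ _
    have hδ1 : δ ≤ 1 := min_le_right _ _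
    have hm0 : (0 : ℝ) ≤ m := Nat.cast_nonneg m
    have hl : l' = k m := by
      let t : ℝ≥0 := ⟨q - δ, by linarith⟩
      have ht : (t : ℝ) = q - δ := rfl
      have h1 := hl' t (by linarith) (by rw [← NNReal.coe_le_coe]; linarith)
      rw [hinterp m t (by linarith) (by linarith), hinterp m q (by linarith) (by linarith),
        level_eq_add _ _ _ q t] at h1
      exact (single_eq_of_smul_eq (by linarith) h1).symm
    have hr : k' = k (m + 1) := by
      let t : ℝ≥0 := ⟨q + δ, by linarith⟩
      have ht : (t : ℝ) = q + δ := rfl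
      have h1 := hk' t (by rw [← NNReal.coe_le_coe]; linarith) (by linarith)
      rw [hinterp (m + 1) t (by push_cast; linarith) (by push_cast; linarith),
        hinterp (m + 1) q (by push_cast; linarith) (by push_cast; linarith),
        level_eq_add _ _ _ q t] at h1
      exact (single_eq_of_smul_eq (by linarith) h1).symm
    subst hl hr
    rcases le_or_gt (k (m + 1)) (k m) with hle | hlt
    · exact hmono _ hle
    · have := hS (by rw [← NNReal.coe_pos]; linarith) hlt _ hlt.le le_rfl
      rw [hq, hL, hL] at this
      exact_mod_cast this.le

end Systems

/-- Dependent choice preserving an invariant `p` and linking consecutive terms by `r`. -/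
theorem exists_seq {α : Type*} (p : ℕ → α → Prop) (r : ℕ → α → α → Prop) (a : α) (ha : p 0 a)
    (hs : ∀ m b, p m b → ∃ b', p (m + 1) b' ∧ r m b b') :
    ∃ s : ℕ → α, s 0 = a ∧ (∀ m, p m (s m)) ∧ ∀ m, r m (s m) (s (m + 1)) := by
  choose! f hf hf' using hs
  let s : ℕ → α := fun m => Nat.rec a f m
  have hp : ∀ m, p m (s m) := by
    intro m
    induction m with
    | zero => exact ha
    | succ m ih => exact hf m (s m) ih
  exact ⟨s, rfl, hp, fun m => hf' m (s m) (hp m)⟩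

/-! ### The two inclusions. -/

section Main

variable {F : Type*} [Field F] [DecidableEq (RatFunc F)] {n : ℕ}

theorem exists_isDiscreteSystem_of_supNorm {u : Fin n → RatFunc.CompletionAtInfty F}
    (hu : supNorm u = 1) :
    ∃ L k, IsDiscreteSystem L k ∧ Interpolates (logMinima u) L k := by
  obtain ⟨hle, j, hj⟩ := (supNorm_eq_one_iff u).1 hu
  choose c hc using fun j => HasLead.exists_of_v_le (N := 0) ((hle j).trans_eq WithZero.exp_zero.symm)
  have hcj : c j ≠ 0 := by
    intro h0
    have := hc j
    rw [h0, HasLead.zero_iff, hj, WithZero.exp_zero] at this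
    exact lt_irrefl _ this
  obtain ⟨x₀, k₀, h₀, hmono₀, -⟩ := (isReduced_single hc).exists_isAdapted_monotone
    (fun _ _ _ => le_rfl) ⟨j, hcj⟩
  obtain ⟨s, hs0, hs, hstep⟩ := exists_seq
    (fun m (a : (Fin n → ℕ) × Fin n) => (∃ x, IsAdapted u m x a.1 a.2) ∧ Monotone a.1 ∧
      Monotone (a.1 + Pi.single a.2 1))
    (fun _ a b => b.1 = a.1 + Pi.single a.2 1 ∧ b.1 b.2 ≤ b.1 a.2) (0, k₀)
    ⟨⟨x₀, h₀⟩, fun _ _ _ => le_rfl, hmono₀⟩ (by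
      rintro m ⟨L, k⟩ ⟨⟨x, hx⟩, -, hmono⟩
      obtain ⟨c, hck, hc⟩ := hx.isReduced_succ
      obtain ⟨x', k', hx', hmono', hle⟩ := hc.exists_isAdapted_monotone hmono ⟨k, hck⟩
      -- The index `k` itself has a nonzero leading coefficient, so the minimality of the new pivot
      -- gives the inequality of the discrete system.
      exact ⟨(L + Pi.single k 1, k'), ⟨⟨x', hx'⟩, hmono, hmono'⟩, rfl, hle k hck⟩)
  have hsys : IsDiscreteSystem (fun m => (s m).1) fun m => (s m).2 :=
    ⟨by simp [hs0], fun m => (hstep m).1, fun m => (hs m).2.1, fun m => (hstep m).2⟩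
  refine ⟨_, _, hsys, fun m q h1 h2 => ?_⟩
  obtain ⟨x, hx⟩ := (hs m).1
  exact hx.logMinima_eq h1 h2 (hsys.monotone_level h1 h2)

variable (F) in
theorem IsDiscreteSystem.exists_supNorm {L : ℕ → Fin n → ℕ} {k : ℕ → Fin n}
    (h : IsDiscreteSystem L k) : ∃ u : Fin n → RatFunc.CompletionAtInfty F,
      supNorm u = 1 ∧ Interpolates (logMinima u) L k := by
  obtain ⟨x₀, hx₀⟩ := exists_isAdapted_single (F := F) (k 0)
  obtain ⟨s, hs0, hs, hstep⟩ := exists_seq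
    (fun m (w : Fin n → RatFunc.CompletionAtInfty F) => ∃ x, IsAdapted w m x (L m) (k m))
    (fun m v w => ∀ j, Valued.v (w j - v j) ≤ exp (-(m : ℤ) - 1)) (Pi.single (k 0) 1)
    ⟨x₀, by rwa [h.zero]⟩ (by
      rintro m v ⟨x, hx⟩
      obtain ⟨w, x', hw, hx'⟩ := hx.exists_succ (k (m + 1)) (by
        rw [← h.succ]
        exact h.le m)
      rw [← h.succ] at hx'
      exact ⟨w, ⟨x', hx'⟩, hw⟩)
  -- The limit agrees with the `m`-th approximation up to degree `-m - 1`, so the basis found at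
  -- stage `m` remains adapted to it.
  choose u hu using fun j => exists_limit (fun m => s m j) fun m => hstep m j
  refine ⟨u, (supNorm_eq_one_iff u).2 ?_, fun m q h1 h2 => ?_⟩
  · have hlt : (exp (-((0 : ℕ) : ℤ) - 1) : ℤᵐ⁰) < 1 := by
      rw [← WithZero.exp_zero, WithZero.exp_lt_exp]
      norm_num
    have hd : ∀ j, Valued.v (u j - (Pi.single (k 0) 1 : Fin n → _) j) < 1 := by
      intro j
      have := hu j 0
      rw [hs0] at this
      exact this.trans_lt hlt
    constructor
    · intro j
      rw [← sub_add_cancel (u j) ((Pi.single (k 0) 1 : Fin n → _) j)]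
      refine (Valuation.map_add _ _ _).trans (max_le (hd j).le ?_)
      rw [Pi.single_apply]
      split_ifs <;> simp
    · refine ⟨k 0, ?_⟩
      have h1 := hd (k 0)
      rw [Pi.single_eq_same] at h1
      exact (Valuation.map_eq_of_sub_lt _ (by rwa [map_one])).trans (map_one _)
  · obtain ⟨x, hx⟩ := hs m
    exact (hx.congr fun j => hu j m).logMinima_eq h1 h2 (h.monotone_level h1 h2)

end Main

end ParamGeom

end

theorem theoremA {F : Type*} [Field F] [DecidableEq (RatFunc F)] (n : ℕ) (hn : 2 ≤ n) :
    {P : ℝ≥0 → Fin n → ℝ | ∃ u : Fin n → RatFunc.CompletionAtInfty F,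
        ParamGeom.supNorm u = 1 ∧ P = ParamGeom.logMinima u} =
      {P : ℝ≥0 → Fin n → ℝ | ParamGeom.IsNSystem P ∧
        ∀ (m : ℕ) (i : Fin n), ∃ z : ℤ, P (m : ℝ≥0) i = (z : ℝ)} := by
  ext P
  constructor
  · rintro ⟨u, hu, rfl⟩
    obtain ⟨L, k, h, hP⟩ := ParamGeom.exists_isDiscreteSystem_of_supNorm hu
    exact ⟨h.isNSystem hP, fun m i => ⟨L m i, by simpa using hP.apply_natCast m i⟩⟩
  · rintro ⟨h, hint⟩
    obtain ⟨L, k, hsys, hP⟩ := h.exists_isDiscreteSystem hint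
    obtain ⟨u, hu, hL⟩ := hsys.exists_supNorm F
    exact ⟨u, hu, hP.eq hL⟩
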